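/- Let $p$ be a prime, let $H$ be a finite group with $O_{p'}(H)=1$ (that is, $H$ has no non-trivial normal subgroup of order prime to $p$), and let $Q$ be a normal $p$-subgroup of $H$ with $C_H(Q)\le Q$. For a subgroup $Q$ of a group $X$ write $\operatorname{Out}_X(Q)\le\operatorname{Out}(Q)=\operatorname{Aut}(Q)/\operatorname{Inn}(Q)$ for the group of classes of the automorphisms of $Q$ induced by conjugation with elements of $N_X(Q)$. A subgroup $K$ of a finite group $X$ is called strongly $p$-embedded if $K\neq X$, $K$ contains a Sylow $p$-subgroup of $X$, and $p\nmid|K\cap gKg^{-1}|$ for every $g\in X\setminus K$. Let $\Delta\le\operatorname{Out}(Q)$ be a subgroup such that $\operatorname{Out}_H(Q)$ is contained in $\Delta$ and is a strongly $p$-embedded subgroup of $\Delta$. Then there exists a finite group $G$ containing $H$ as a subgroup with $p\nmid|G:H|$ such that $Q\trianglelefteq G$ and $\operatorname{Out}_G(Q)=\Delta$ as subgroups of $\operatorname{Out}(Q)$; in particular $\operatorname{Out}_G(Q)\cong\Delta$. -/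

import Mathlib

universe u

/-- The group `Inn(N)` of inner automorphisms of `N`. -/
def Inn (N : Type*) [Group N] : Subgroup (MulAut N) :=
  (MulAut.conj : N →* MulAut N).range

theorem mulAut_conj_apply_eq {N : Type*} [Group N] (α : MulAut N) (n : N) :
    α * MulAut.conj n * α⁻¹ = MulAut.conj (α n) := by
  ext x
  simp

instance instNormalInn (N : Type*) [Group N] : (Inn N).Normal := by
  constructor
  rintro _ ⟨n, rfl⟩ α
  exact ⟨α n, (mulAut_conj_apply_eq α n).symm⟩

/-- The outer automorphism group `Out(N) = Aut(N) / Inn(N)`. -/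
abbrev OuterAut (N : Type*) [Group N] : Type _ := MulAut N ⧸ Inn N

theorem map_inn_congr {N M : Type*} [Group N] [Group M] (e : N ≃* M) :
    (Inn N).map (MulAut.congr e : MulAut N →* MulAut M) = Inn M := by
  have key : ∀ n : N, MulAut.congr e (MulAut.conj n) = MulAut.conj (e n) := by
    intro n
    ext x
    simp [MulAut.congr]
  ext β
  constructor
  · rintro ⟨_, ⟨n, rfl⟩, rfl⟩
    exact ⟨e n, (key n).symm⟩
  · rintro ⟨m, rfl⟩
    refine ⟨MulAut.conj (e.symm m), ⟨_, rfl⟩, ?_⟩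
    simpa using key (e.symm m)

/-- The isomorphism `Out(N) ≃* Out(M)`, `[α] ↦ [e ∘ α ∘ e⁻¹]`, induced by an isomorphism
`e : N ≃* M`. -/
def OuterAut.congr {N M : Type*} [Group N] [Group M] (e : N ≃* M) :
    OuterAut N ≃* OuterAut M :=
  QuotientGroup.congr (Inn N) (Inn M) (MulAut.congr e) (map_inn_congr e)

/-- For a subgroup `Q ≤ G`, the subgroup `Out_G(Q) = Aut_G(Q) / Inn(Q)` of `Out(Q)`: the classes of
the automorphisms of `Q` that are induced by conjugation with elements of `N_G(Q)`. -/
def outIn {G : Type*} [Group G] (Q : Subgroup G) : Subgroup (OuterAut Q) :=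
  ((QuotientGroup.mk' (Inn Q)).comp Q.normalizerMonoidHom).range

/-- `O_{p'}(G)`: the subgroup generated by all normal subgroups of `G` of order prime to `p`
(for finite `G`, the largest such subgroup). -/
def pPrimeCore (p : ℕ) (G : Type*) [Group G] : Subgroup G :=
  sSup {N : Subgroup G | N.Normal ∧ ¬ p ∣ Nat.card N}

open scoped Pointwise in
/-- A subgroup `K` of a finite group `X` is strongly `p`-embedded if it is proper, contains a Sylow
`p`-subgroup of `X`, and meets each of its conjugates by an element outside `K` in a `p'`-group. -/
structure IsStronglyPEmbedded (p : ℕ) {X : Type*} [Group X] (K : Subgroup X) : Prop where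
  lt_top : K < ⊤
  exists_sylow_le : ∃ P : Sylow p X, (P : Subgroup X) ≤ K
  not_dvd_card_inf_conj :
    ∀ g : X, g ∉ K → ¬ p ∣ Nat.card (K ⊓ MulAut.conj g • K : Subgroup X)

/-! Let `X = Δ / Out_H(Q)`, `Z = Z(Q)`, and let `Γ` be the preimage of `Δ` in `Aut(Q)`. Families of
elements of `H` indexed by `X`, whose actions on `Q` are those prescribed by one `γ ∈ Γ` through
coset representatives, form a group `E` (`twistedWreath`). As `C_H(Q) ≤ Q`, it is an extension of
`Γ` by `Z^X`; modulo a diagonal copy of `Q` it is an extension of `Δ` by `Z^X / Z`. If the latter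
splits, the preimage `G` of a complement is an extension of `Δ` by `Q`, and evaluation at the base
point identifies a point stabilizer in `G` with `H`.

Strong embedding gives the splitting. By `exists_complement_of_trace` it suffices that the identity
of `Z^X / Z` is a trace. Since `p ∤ |X|`, modulo constants the identity is `m x ↦ ∏ c, (m x / m c) ^
(1 / |X|)`, which involves only pairs `c ≠ x`. Such pairs have `p'`-stabilizers in `Δ`, so dividing
by stabilizer orders gives weights that realize this map as a trace. -/

/-- A group action admits a weight function on points whose sum over each orbit map with stabilizer
of order coprime to `q` is a prescribed number modulo `q`. -/
theorem exists_weight_sum_smul_modEq {D Ω : Type*} [Group D] [Fintype D] [MulAction D Ω]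
    (q N : ℕ) :
    ∃ w : Ω → ℕ, ∀ ω : Ω, (Nat.card (MulAction.stabilizer D ω)).Coprime q →
      ∑ δ : D, w (δ • ω) ≡ N [MOD q] := by
  classical
  have hinv : ∀ ω : Ω, ∃ k : ℕ, (Nat.card (MulAction.stabilizer D ω)).Coprime q →
      Nat.card (MulAction.stabilizer D ω) * k ≡ N [MOD q] := by
    intro ω
    by_cases h : (Nat.card (MulAction.stabilizer D ω)).Coprime q
    · rcases eq_or_ne q 0 with rfl | hq
      · refine ⟨N, fun h' => ?_⟩
        -- Modulo `0`, coprimality forces a trivial stabilizer, and `k = N` solves the equation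
        -- exactly.
        rw [(Nat.coprime_zero_right _).mp h', one_mul]
      · obtain ⟨k, -, hk⟩ := Nat.exists_mul_mod_eq_of_coprime N h hq
        exact ⟨k, fun _ => hk⟩
    · exact ⟨0, fun h' => absurd h' h⟩
  choose k hk using hinv
  let rep : Ω → Ω := fun ω => (Quotient.mk (MulAction.orbitRel D Ω) ω).out
  have hrep : ∀ (δ : D) (ω : Ω), rep (δ • ω) = rep ω := by
    intro δ ω
    have : (Quotient.mk (MulAction.orbitRel D Ω) (δ • ω)) = Quotient.mk _ ω :=
      Quotient.sound ⟨δ, rfl⟩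
    simp only [rep, this]
  have hmem : ∀ ω : Ω, ∃ δ : D, δ • ω = rep ω := fun ω =>
    MulAction.mem_orbit_iff.mp (Quotient.mk_out (s := MulAction.orbitRel D Ω) ω)
  -- All weight sits on one representative per orbit, which an orbit map hits once for each
  -- stabilizer element.
  refine ⟨fun ω => if ω = rep ω then k ω else 0, fun ω hω => ?_⟩
  obtain ⟨δ₀, hδ₀⟩ := hmem ω
  have hcard : Nat.card (MulAction.stabilizer D (rep ω)) =
      Nat.card (MulAction.stabilizer D ω) := by
    rw [← hδ₀, MulAction.stabilizer_smul_eq_stabilizer_map_conj]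
    exact Subgroup.card_map_of_injective (MulAut.conj δ₀).injective
  have hsum : ∑ δ : D, (if δ • ω = rep (δ • ω) then k (δ • ω) else 0) =
      Nat.card (MulAction.stabilizer D (rep ω)) * k (rep ω) := by
    rw [← Equiv.sum_comp (Equiv.mulRight δ₀)]
    simp only [Equiv.coe_mulRight, mul_smul, hδ₀, hrep]
    have h1 : ∀ δ : D, (if δ • rep ω = rep (rep ω) then k (δ • rep ω) else 0) =
        if δ ∈ MulAction.stabilizer D (rep ω) then k (rep ω) else 0 := by
      intro δ
      have h2 : rep (rep ω) = rep ω := by rw [← hδ₀, hrep, hδ₀]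
      simp only [h2, MulAction.mem_stabilizer_iff]
      split_ifs with h
      · rw [h]
      · rfl
    rw [Finset.sum_congr rfl fun δ _ => h1 δ, ← Finset.sum_filter, Finset.sum_const,
      smul_eq_mul, Nat.card_eq_fintype_card, Fintype.card_subtype]
  rw [hsum]
  exact hk _ (hcard ▸ hω)

/-! ### Splitting an extension by averaging its cocycle -/

/-- A form of Higman's criterion: the extension of `D` by the image of `M` in `E ⧸ Q` splits if the
identity of that image is a trace `∏ y, θ y`. -/
theorem exists_complement_of_trace {E D M : Type*} [Group E] [Group D] [Fintype D] [CommGroup M]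
    (Q : Subgroup E) [Q.Normal] (π : E →* D) (hπ : Function.Surjective π) (hQ : Q ≤ π.ker)
    (j : M →* E) (hj : ∀ m, π (j m) = 1)
    (hker : ∀ e, π e = 1 → ∃ m, ∃ q ∈ Q, e = j m * q)
    (act : E → M →* M) (hact : ∀ e m, e * j m * e⁻¹ = j (act e m))
    (θ : D → M →* M) (hθact : ∀ e y m, act e (θ y m) = θ (π e * y) (act e m))
    (hθ : ∀ y m, j m ∈ Q → θ y m = 1) (htrace : ∀ m, j ((∏ y, θ y m)⁻¹ * m) ∈ Q) :
    ∃ G : Subgroup E, Q ≤ G ∧ (∀ d, ∃ e ∈ G, π e = d) ∧ ∀ e ∈ G, π e = 1 → e ∈ Q := by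
  choose s hs using hπ
  have hf : ∀ g h : D, ∃ m, (s g * s h : E ⧸ Q) = (j m : E ⧸ Q) * (s (g * h) : E ⧸ Q) := by
    intro g h
    obtain ⟨m, q, hq, e⟩ := hker (s g * s h * (s (g * h))⁻¹) (by simp [hs])
    refine ⟨m, ?_⟩
    have h1 : s g * s h = j m * q * s (g * h) := by rw [← e]; group
    have h2 : (q : E ⧸ Q) = 1 := (QuotientGroup.eq_one_iff q).mpr hq
    rw [← QuotientGroup.mk_mul, h1, QuotientGroup.mk_mul, QuotientGroup.mk_mul, h2, mul_one]
  choose f hf using hf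
  -- The factor set `f` satisfies the cocycle identity only modulo `Q`; `θ y` does not see the
  -- difference.
  have hθeq : ∀ y a b, (j a : E ⧸ Q) = (j b : E ⧸ Q) → θ y a = θ y b := by
    intro y a b hab
    have := hθ y (a⁻¹ * b) (by rw [map_mul, map_inv]; exact QuotientGroup.eq.mp hab)
    rw [map_mul, map_inv] at this
    exact (inv_mul_eq_one.mp this)
  have hactq : ∀ (e : E) m, (e : E ⧸ Q) * (j m : E ⧸ Q) = (j (act e m) : E ⧸ Q) * (e : E ⧸ Q) := by
    intro e m
    rw [← hact, ← QuotientGroup.mk_mul, ← QuotientGroup.mk_mul]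
    congr 1
    group
  have hcocycle : ∀ g h k, (j (act (s g) (f h k) * f g (h * k)) : E ⧸ Q) =
      (j (f g h * f (g * h) k) : E ⧸ Q) := by
    intro g h k
    apply mul_right_cancel (b := (s (g * h * k) : E ⧸ Q))
    simp only [map_mul, QuotientGroup.mk_mul]
    rw [mul_assoc, mul_assoc _ _ (s (g * h * k) : E ⧸ Q), ← hf (g * h) k, ← mul_assoc _ (s (g * h) : E ⧸ Q),
      ← hf g h, mul_assoc g h k, ← hf g (h * k), ← mul_assoc, ← hactq, mul_assoc, mul_assoc, ← hf h k]
  -- Applying `θ y` to the cocycle identity for `(g, h, k)` with `g * h * k = y` and multiplying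
  -- over `y` shows that `f` is the coboundary of `v` modulo `Q`.
  let v : D → M := fun g => ∏ y, θ y (f g (g⁻¹ * y))
  have hv : ∀ g h, (j (v g * act (s g) (v h)) : E ⧸ Q) = (j (f g h * v (g * h)) : E ⧸ Q) := by
    intro g h
    have h1 : act (s g) (v h) = ∏ y, θ y (act (s g) (f h (h⁻¹ * (g⁻¹ * y)))) := by
      simp only [v, map_prod, hθact, hs]
      rw [← Equiv.prod_comp (Equiv.mulLeft g)
        fun y => θ y (act (s g) (f h (h⁻¹ * (g⁻¹ * y))))]
      simp
    have h2 : v g * act (s g) (v h) = (∏ y, θ y (f g h)) * v (g * h) := by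
      rw [h1]
      simp only [v]
      rw [← Finset.prod_mul_distrib, ← Finset.prod_mul_distrib]
      refine Finset.prod_congr rfl fun y _ => ?_
      have := hθeq y _ _ (hcocycle g h (h⁻¹ * (g⁻¹ * y)))
      rw [mul_inv_cancel_left] at this
      rw [mul_comm, ← map_mul, this, map_mul, mul_inv_rev, mul_assoc]
    rw [h2, map_mul, map_mul, QuotientGroup.mk_mul, QuotientGroup.mk_mul]
    congr 1
    exact QuotientGroup.eq.mpr (by rw [← map_inv, ← map_mul]; exact htrace _)
  let σ : D →* E ⧸ Q := MonoidHom.mk' (fun g => (j (v g) : E ⧸ Q)⁻¹ * (s g : E ⧸ Q)) (by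
    intro g h
    have h3 : (s g : E ⧸ Q) * (j (v h) : E ⧸ Q)⁻¹ =
        (j (act (s g) (v h)) : E ⧸ Q)⁻¹ * (s g : E ⧸ Q) := by
      rw [mul_inv_eq_iff_eq_mul, mul_assoc, hactq, inv_mul_cancel_left]
    have h4 := hv g h
    simp only [map_mul, QuotientGroup.mk_mul] at h4
    have h5 : (j (act (s g) (v h)) : E ⧸ Q) * (j (v g) : E ⧸ Q) =
        (j (f g h) : E ⧸ Q) * (j (v (g * h)) : E ⧸ Q) := by
      rw [← h4, ← QuotientGroup.mk_mul, ← QuotientGroup.mk_mul, ← map_mul, ← map_mul, mul_comm]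
    rw [mul_assoc, ← mul_assoc (s g : E ⧸ Q), h3, mul_assoc, hf g h, ← mul_assoc, ← mul_assoc,
      ← mul_inv_rev, h5, mul_inv_rev, inv_mul_cancel_right])
  refine ⟨σ.range.comap (QuotientGroup.mk' Q), fun q hq => ⟨1, ?_⟩, fun d =>
    ⟨(j (v d))⁻¹ * s d, ⟨d, rfl⟩, by simp [hs, hj]⟩, ?_⟩
  · rw [map_one]
    exact ((QuotientGroup.eq_one_iff q).mpr hq).symm
  · rintro e ⟨d, hd⟩ he
    have h1 : QuotientGroup.lift Q π hQ (σ d) = d := by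
      simp [σ, hs, hj]
    rw [hd] at h1
    have h2 : d = 1 := h1.symm.trans he
    rw [h2, map_one] at hd
    exact (QuotientGroup.eq_one_iff e).mp hd.symm

/-! ### The identity modulo constants as a trace -/

/-- The endomorphism `m ↦ (x ↦ ∏ c, (m x / m c) ^ w (y⁻¹ • (c, x)))` of a group of functions. -/
def weightedDifference {D X A : Type*} [Group D] [Fintype X] [MulAction D X] [CommGroup A]
    (w : X × X → ℕ) (y : D) : (X → A) →* (X → A) where
  toFun m x := ∏ c, (m x / m c) ^ w (y⁻¹ • (c, x))
  map_one' := by ext; simp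
  map_mul' m m' := by
    ext x
    simp [← Finset.prod_mul_distrib, ← mul_pow, mul_div_mul_comm]

theorem prod_weightedDifference {D X A : Type*} [Group D] [Fintype D] [Fintype X] [MulAction D X]
    [CommGroup A] {w : X × X → ℕ} {q N : ℕ} (hA : ∀ a : A, a ^ q = 1)
    (hN : Fintype.card X * N ≡ 1 [MOD q])
    (hw : ∀ c x : X, c ≠ x → ∑ δ : D, w (δ • (c, x)) ≡ N [MOD q]) (m : X → A) :
    ∃ a : A, ∀ x, (∏ y : D, weightedDifference w y m) x = m x * a := by
  refine ⟨((∏ c, m c) ^ N)⁻¹, fun x => ?_⟩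
  have hpow : ∀ (a : A) {k l : ℕ}, k ≡ l [MOD q] → a ^ k = a ^ l := fun a k l h =>
    pow_eq_pow_iff_modEq.mpr (h.of_dvd (orderOf_dvd_of_pow_eq_one (hA a)))
  have h1 : ∀ c, ∏ y : D, (m x / m c) ^ w (y⁻¹ • (c, x)) = (m x / m c) ^ N := by
    intro c
    rcases eq_or_ne c x with rfl | hc
    -- Diagonal pairs contribute `m x / m x = 1`, so their stabilizers are irrelevant.
    · simp
    · rw [Finset.prod_pow_eq_pow_sum, show ∑ y : D, w (y⁻¹ • (c, x)) = ∑ y : D, w (y • (c, x)) from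
        Equiv.sum_comp (Equiv.inv D) fun y => w (y • (c, x))]
      exact hpow _ (hw c x hc)
  rw [Finset.prod_apply]
  simp only [weightedDifference, MonoidHom.coe_mk, OneHom.coe_mk]
  rw [Finset.prod_comm, Finset.prod_congr rfl fun c _ => h1 c, Finset.prod_pow,
    Finset.prod_div_distrib, Finset.prod_const, div_pow, ← pow_mul, Finset.card_univ,
    hpow _ hN, pow_one, div_eq_mul_inv]

section CenterAct

open scoped IsMulCommutative

variable {Q : Type*} [Group Q] {Γ X : Type*} [Group Γ] [MulAction Γ X] {α : Γ →* MulAut Q}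

theorem Subgroup.coe_centerCongr_mulAut (β : MulAut Q) (z : Subgroup.center Q) :
    (Subgroup.centerCongr β z : Q) = β z := rfl

/-- The action of `Γ` on the functions with values in the center of `Q`. -/
def centerAct (α : Γ →* MulAut Q) (γ : Γ) : (X → Subgroup.center Q) →* (X → Subgroup.center Q) where
  toFun m x := Subgroup.centerCongr (α γ) (m (γ⁻¹ • x))
  map_one' := by ext; simp
  map_mul' m m' := by ext; simp

theorem centerAct_weightedDifference {D : Type*} [Group D] [Fintype X] [MulAction D X] (π : Γ →* D)
    (hπ : ∀ (γ : Γ) (x : X), γ • x = π γ • x) (w : X × X → ℕ) (γ : Γ) (y : D)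
    (m : X → Subgroup.center Q) :
    centerAct α γ (weightedDifference w y m) = weightedDifference w (π γ * y) (centerAct α γ m) := by
  ext1 x
  simp only [centerAct, weightedDifference, MonoidHom.coe_mk, OneHom.coe_mk, map_prod, map_pow,
    map_div]
  symm
  rw [← Equiv.prod_comp (MulAction.toPerm γ)]
  simp [hπ, mul_smul]

end CenterAct

/-! ### The twisted wreath product -/

section TwistedWreath

open scoped IsMulCommutative

variable {H : Type*} [Group H] (Q : Subgroup H) [Q.Normal] {Γ X : Type*} [Group Γ]
  [MulAction Γ X] (α : Γ →* MulAut Q) (t : X → Γ)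

/-- The group of pairs `(n, γ)` in the wreath product of `H` with `Γ` over `X` such that each `n x`
induces on `Q` the automorphism `(t x)⁻¹ γ t (γ⁻¹ x)`. -/
def twistedWreath : Subgroup ((X → H) ⋊[(mulAutArrow : Γ →* MulAut (X → H))] Γ) where
  carrier := {e | ∀ x, MulAut.conjNormal (e.left x) =
    (α (t x))⁻¹ * α e.right * α (t (e.right⁻¹ • x))}
  one_mem' x := by simp
  mul_mem' := by
    intro e e' he he' x
    have h : (e * e').left x = e.left x * e'.left (e.right⁻¹ • x) := rfl
    rw [h, map_mul, he, he', SemidirectProduct.mul_right, mul_inv_rev, mul_smul, map_mul]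
    group
  inv_mem' := by
    intro e he x
    have h : e⁻¹.left x = (e.left (e.right⁻¹⁻¹ • x))⁻¹ := rfl
    rw [h, map_inv, he, SemidirectProduct.inv_right, inv_inv, inv_smul_smul, map_inv]
    group

namespace twistedWreath

variable {Q α t}

theorem conjNormal_left (e : twistedWreath Q α t) (x : X) : MulAut.conjNormal (e.1.left x) =
    (α (t x))⁻¹ * α e.1.right * α (t (e.1.right⁻¹ • x)) := e.2 x

theorem mul_left_apply (e e' : twistedWreath Q α t) (x : X) :
    (e * e').1.left x = e.1.left x * e'.1.left (e.1.right⁻¹ • x) := rfl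

theorem inv_left_apply (e : twistedWreath Q α t) (x : X) :
    (e⁻¹).1.left x = (e.1.left (e.1.right⁻¹⁻¹ • x))⁻¹ := rfl

theorem ext_iff' {e e' : twistedWreath Q α t} :
    e = e' ↔ (∀ x, e.1.left x = e'.1.left x) ∧ e.1.right = e'.1.right := by
  rw [Subtype.ext_iff, SemidirectProduct.ext_iff, funext_iff]

variable (Q α t) in
/-- The projection of the twisted wreath product onto `Γ`. -/
def toRight : twistedWreath Q α t →* Γ :=
  SemidirectProduct.rightHom.comp (twistedWreath Q α t).subtype

theorem conjNormal_center (z : Subgroup.center Q) :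
    MulAut.conjNormal ((z : Q) : H) = (1 : MulAut Q) := by
  ext q
  have := congrArg (Subtype.val) (Subgroup.mem_center_iff.mp z.2 q)
  simp only [Subgroup.coe_mul] at this
  simp [← this]

variable (Q α t) in
/-- The embedding of the functions with values in the center of `Q`. -/
def ofCenter : (X → Subgroup.center Q) →* twistedWreath Q α t where
  toFun m := ⟨⟨fun x => ((Subgroup.centerCongr (α (t x))⁻¹ (m x) : Q) : H), 1⟩, fun x => by
    simp [conjNormal_center]⟩
  map_one' := by
    rw [ext_iff']
    exact ⟨fun x => by simp, rfl⟩
  map_mul' m m' := by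
    rw [ext_iff']
    refine ⟨fun x => ?_, by simp⟩
    rw [mul_left_apply]
    simp

/-- The factors `(α (t x))⁻¹` in `ofCenter` cancel the twist by `t`, leaving the plain permutation
action. -/
theorem conj_ofCenter (e : twistedWreath Q α t) (m : X → Subgroup.center Q) :
    e * ofCenter Q α t m * e⁻¹ = ofCenter Q α t (centerAct α e.1.right m) := by
  rw [ext_iff']
  refine ⟨fun x => ?_, ?_⟩
  · have h := DFunLike.congr_fun (conjNormal_left e x)
      (Subgroup.centerCongr (α (t (e.1.right⁻¹ • x)))⁻¹ (m (e.1.right⁻¹ • x)) : Q)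
    have h' := congrArg Subtype.val h
    rw [MulAut.conjNormal_apply] at h'
    rw [mul_left_apply, mul_left_apply, inv_left_apply]
    simpa [ofCenter, centerAct, Subgroup.coe_centerCongr_mulAut] using h'
  · simp [ofCenter]

variable (α t) in
/-- The diagonal embedding of `Q`. -/
def ofNormal (c : Q →* Γ) (hc : ∀ q, α (c q) = MulAut.conj q) (hcX : ∀ q (x : X), c q • x = x) :
    Q →* twistedWreath Q α t where
  toFun q := ⟨⟨fun x => ((α (t x))⁻¹ q : Q), c q⟩, fun x => by
    have h := mulAut_conj_apply_eq (α (t x))⁻¹ q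
    rw [MulAut.conjNormal_val, hc, ← map_inv c, hcX, ← h, inv_inv]⟩
  map_one' := by
    rw [ext_iff']
    exact ⟨fun x => by simp, by simp⟩
  map_mul' m m' := by
    rw [ext_iff']
    refine ⟨fun x => ?_, by simp⟩
    rw [mul_left_apply]
    simp [← map_inv, hcX]

variable {c : Q →* Γ} {hc : ∀ q, α (c q) = MulAut.conj q} {hcX : ∀ q (x : X), c q • x = x}

theorem conj_ofNormal (hα : Function.Injective α) (e : twistedWreath Q α t) (q : Q) :
    e * ofNormal α t c hc hcX q * e⁻¹ = ofNormal α t c hc hcX (α e.1.right q) := by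
  rw [ext_iff']
  refine ⟨fun x => ?_, ?_⟩
  · have h := DFunLike.congr_fun (conjNormal_left e x) ((α (t (e.1.right⁻¹ • x)))⁻¹ q)
    have h' := congrArg Subtype.val h
    rw [MulAut.conjNormal_apply] at h'
    rw [mul_left_apply, mul_left_apply, inv_left_apply]
    have hcX' : ∀ x : X, (c q)⁻¹ • x = x := fun x => by rw [inv_smul_eq_iff, hcX]
    simpa [ofNormal, mul_smul, hcX'] using h'
  · apply hα
    have h := mulAut_conj_apply_eq (α e.1.right) q
    simp [ofNormal, hc, h]

theorem ofNormal_center (hα : Function.Injective α) (a : Subgroup.center Q) :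
    ofNormal α t c hc hcX a = ofCenter Q α t fun _ => a := by
  rw [ext_iff']
  refine ⟨fun x => by simp [ofNormal, ofCenter, Subgroup.coe_centerCongr_mulAut], hα ?_⟩
  ext q
  simp [ofNormal, ofCenter, hc, ← Subgroup.mem_center_iff.mp a.2 q]

theorem eq_of_ofCenter_eq_ofNormal {m : X → Subgroup.center Q} {q : Q}
    (h : ofCenter Q α t m = ofNormal α t c hc hcX q) (x : X) : (m x : Q) = q := by
  have := (ext_iff'.mp h).1 x
  simpa [ofNormal, ofCenter, Subgroup.coe_centerCongr_mulAut] using this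

/-- After dividing by the diagonal element, every coordinate centralizes `Q`, hence lies in `Z(Q)`.
-/
theorem exists_ofCenter_mul_ofNormal (hQ : Subgroup.centralizer (Q : Set H) ≤ Q)
    {e : twistedWreath Q α t} {q : Q} (he : e.1.right = c q) :
    ∃ m, e = ofCenter Q α t m * ofNormal α t c hc hcX q := by
  set e' := e * (ofNormal α t c hc hcX q)⁻¹ with he'
  have h1 : e'.1.right = 1 := by simp [he', ofNormal, he]
  have h2 : ∀ x, ∃ z : Subgroup.center Q, ((z : Q) : H) = e'.1.left x := by
    intro x
    have h3 := conjNormal_left e' x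
    rw [h1, inv_one, one_smul, map_one, mul_one, inv_mul_cancel] at h3
    have h4 : ∀ y : Q, e'.1.left x * y = y * e'.1.left x := by
      intro y
      have := congrArg Subtype.val (DFunLike.congr_fun h3 y)
      rw [MulAut.conjNormal_apply] at this
      exact mul_inv_eq_iff_eq_mul.mp this
    have h5 : e'.1.left x ∈ Q := hQ (Subgroup.mem_centralizer_iff.mpr fun y hy => (h4 ⟨y, hy⟩).symm)
    exact ⟨⟨⟨_, h5⟩, Subgroup.mem_center_iff.mpr fun y => Subtype.ext (h4 y).symm⟩, rfl⟩
  choose z hz using h2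
  refine ⟨fun x => Subgroup.centerCongr (α (t x)) (z x), ?_⟩
  rw [← mul_inv_eq_iff_eq_mul, ← he', ext_iff']
  exact ⟨fun x => by simp [ofCenter, hz, Subgroup.coe_centerCongr_mulAut], h1⟩

/-- Each `(t x)⁻¹ * γ * t (γ⁻¹ • x)` fixes `x₀`, so `H` induces it, and the coordinates can be
chosen independently. -/
theorem exists_right_eq {x₀ : X} (ht : ∀ x, t x • x₀ = x)
    (hstab : ∀ γ : Γ, γ • x₀ = x₀ → ∃ h : H, MulAut.conjNormal h = α γ) (γ : Γ) :
    ∃ e : twistedWreath Q α t, e.1.right = γ := by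
  have h : ∀ x, ∃ h : H, MulAut.conjNormal h = (α (t x))⁻¹ * α γ * α (t (γ⁻¹ • x)) := by
    intro x
    obtain ⟨h, hh⟩ := hstab ((t x)⁻¹ * γ * t (γ⁻¹ • x)) (by
      rw [mul_smul, ht, mul_smul, smul_inv_smul, inv_smul_eq_iff, ht])
    exact ⟨h, by rw [hh]; simp⟩
  choose n hn using h
  exact ⟨⟨⟨n, γ⟩, hn⟩, rfl⟩

end twistedWreath

end TwistedWreath

/-! ### The extension of `D` by `Q` and the copy of `H` inside it -/

namespace twistedWreath

open scoped IsMulCommutative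

variable {H : Type*} [Group H] {Q : Subgroup H} [Q.Normal] {Γ X D : Type*} [Group Γ]
  [MulAction Γ X] {α : Γ →* MulAut Q} {t : X → Γ} [Group D] [MulAction D X]
  {c : Q →* Γ} {hc : ∀ q, α (c q) = MulAut.conj q} {hcX : ∀ q (x : X), c q • x = x}

/-- The twisted wreath product contains an extension of `D` by `Q`. -/
theorem exists_extension {p : ℕ} [Fact p.Prime] [Finite D] [Finite X] [Finite Q]
    (hα : Function.Injective α) (hQp : IsPGroup p Q) (hQ : Subgroup.centralizer (Q : Set H) ≤ Q)
    (π : Γ →* D) (hπ : Function.Surjective π) (hπX : ∀ (γ : Γ) (x : X), γ • x = π γ • x)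
    (hπc : ∀ γ, π γ = 1 ↔ ∃ q, γ = c q) {x₀ : X} (ht : ∀ x, t x • x₀ = x)
    (hstab : ∀ γ : Γ, γ • x₀ = x₀ → ∃ h : H, MulAut.conjNormal h = α γ)
    (hX : ¬ p ∣ Nat.card X)
    (hD : ∀ x y : X, x ≠ y → ¬ p ∣ Nat.card (MulAction.stabilizer D (x, y))) :
    ∃ G : Subgroup (twistedWreath Q α t), (ofNormal α t c hc hcX).range ≤ G ∧
      (∀ d, ∃ e ∈ G, π e.1.right = d) ∧
      ∀ e ∈ G, π e.1.right = 1 → e ∈ (ofNormal α t c hc hcX).range := by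
  have := Fintype.ofFinite D
  have := Fintype.ofFinite X
  have hp : p.Prime := Fact.out
  obtain ⟨k, hk⟩ := IsPGroup.iff_card.mp hQp
  have hcop : ∀ n, ¬ p ∣ n → n.Coprime (p ^ k) := fun n hn =>
    ((hp.coprime_iff_not_dvd.mpr hn).pow_left k).symm
  have hA : ∀ a : Subgroup.center Q, a ^ p ^ k = 1 := fun a => Subtype.ext (by
    rw [← hk]
    exact pow_card_eq_one')
  obtain ⟨N, -, hN⟩ := Nat.exists_mul_mod_eq_of_coprime 1 (hcop _ hX) (pow_ne_zero k hp.ne_zero)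
  rw [Nat.card_eq_fintype_card] at hN
  obtain ⟨w, hw⟩ := exists_weight_sum_smul_modEq (D := D) (Ω := X × X) (p ^ k) N
  have hnormal : (ofNormal α t c hc hcX).range.Normal := by
    refine ⟨?_⟩
    rintro _ ⟨q, rfl⟩ e
    exact ⟨_, (conj_ofNormal hα e q).symm⟩
  have hsurj : Function.Surjective (π.comp (toRight Q α t)) := by
    intro d
    obtain ⟨γ, rfl⟩ := hπ d
    obtain ⟨e, rfl⟩ := exists_right_eq (Q := Q) (α := α) ht hstab γ
    exact ⟨e, rfl⟩
  refine exists_complement_of_trace (ofNormal α t c hc hcX).range (π.comp (toRight Q α t)) hsurj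
    ?_ (ofCenter Q α t) ?_ ?_ (fun e => centerAct α e.1.right) (fun e m => conj_ofCenter e m)
    (weightedDifference w) ?_ ?_ ?_
  · rintro _ ⟨q, rfl⟩
    exact (hπc _).mpr ⟨q, rfl⟩
  · intro m
    exact map_one π
  · intro e he
    obtain ⟨q, hq⟩ := (hπc _).mp he
    obtain ⟨m, hm⟩ := exists_ofCenter_mul_ofNormal (hc := hc) (hcX := hcX) hQ hq
    exact ⟨m, _, ⟨q, rfl⟩, hm⟩
  · intro e y m
    exact centerAct_weightedDifference π hπX w e.1.right y m
  · rintro y m ⟨q, hq⟩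
    have hm : ∀ x x', m x = m x' := fun x x' => Subtype.ext
      ((eq_of_ofCenter_eq_ofNormal hq.symm x).trans (eq_of_ofCenter_eq_ofNormal hq.symm x').symm)
    ext1 x
    exact Finset.prod_eq_one fun z _ => by rw [hm x z, div_self', one_pow]
  · intro m
    obtain ⟨a, ha⟩ := prod_weightedDifference hA hN
      (fun x y hxy => hw (x, y) (hcop _ (hD x y hxy))) m
    refine ⟨a⁻¹, ?_⟩
    have := ofNormal_center (t := t) (hc := hc) (hcX := hcX) hα a⁻¹
    rw [Subgroup.coe_inv] at this
    rw [this]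
    congr 1
    ext1 x
    rw [Pi.mul_apply, Pi.inv_apply, ha, mul_inv_rev, inv_mul_cancel_right]

/-- An extension of `D` by `Q` in the twisted wreath product contains a copy of `H`, namely the
stabilizer of the base point. -/
theorem exists_embedding (hα : Function.Injective α)
    (hQ : Subgroup.centralizer (Q : Set H) ≤ Q)
    (π : Γ →* D) (hπX : ∀ (γ : Γ) (x : X), γ • x = π γ • x)
    (hπc : ∀ γ, π γ = 1 ↔ ∃ q, γ = c q) {x₀ : X} (ht₀ : t x₀ = 1)
    (hrange : ∀ h : H, ∃ γ : Γ, γ • x₀ = x₀ ∧ α γ = MulAut.conjNormal h)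
    (G : Subgroup (twistedWreath Q α t)) (hQG : (ofNormal α t c hc hcX).range ≤ G)
    (hG : ∀ d, ∃ e ∈ G, π e.1.right = d)
    (hGQ : ∀ e ∈ G, π e.1.right = 1 → e ∈ (ofNormal α t c hc hcX).range) :
    ∃ ι : H →* G, Function.Injective ι ∧
      (∀ (g : G) (q : Q), g * ι q * g⁻¹ = ι (α g.1.1.right q : Q)) ∧
      ∀ g : G, g ∈ ι.range ↔ π g.1.1.right • x₀ = x₀ := by
  have hleft : ∀ q, (ofNormal α t c hc hcX q).1.left x₀ = q := fun q => by
    change (((α (t x₀))⁻¹ q : Q) : H) = q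
    rw [ht₀, map_one, inv_one, MulAut.one_apply]
  have hinv : ∀ γ : Γ, γ • x₀ = x₀ → γ⁻¹ • x₀ = x₀ := fun γ h => inv_smul_eq_iff.mpr h.symm
  have hact : ∀ e : twistedWreath Q α t, e.1.right • x₀ = x₀ →
      MulAut.conjNormal (e.1.left x₀) = α e.1.right := fun e he => by
    rw [conjNormal_left, hinv _ he, ht₀, map_one, inv_one, one_mul, mul_one]
  let S : Subgroup G := (MulAction.stabilizer Γ x₀).comap ((toRight Q α t).comp G.subtype)
  have hS : ∀ g : G, g ∈ S ↔ g.1.1.right • x₀ = x₀ := fun g => Iff.rfl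
  let ev : S →* H := MonoidHom.mk' (fun g => g.1.1.1.left x₀) fun g g' => by
    have := mul_left_apply g.1.1 g'.1.1 x₀
    rwa [hinv _ ((hS _).mp g.2)] at this
  have hev : ∀ g : S, ev g = g.1.1.1.left x₀ := fun g => rfl
  have hinj : Function.Injective ev := by
    rw [injective_iff_map_eq_one]
    intro g hg
    have h1 := hact g.1.1 g.2
    rw [← hev, hg, map_one] at h1
    -- The coordinate at `x₀` determines the action on `Q`, hence `γ`; what remains lies in the
    -- diagonal `Q`, where evaluation is faithful.
    have h2 : g.1.1.1.right = 1 := hα (by rw [← h1, map_one])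
    obtain ⟨q, hq⟩ := hGQ g.1.1 g.1.2 (by rw [h2, map_one])
    have h3 := hleft q
    rw [hq, ← hev, hg] at h3
    have h4 : q = 1 := Subtype.ext h3.symm
    rw [h4, map_one] at hq
    exact Subtype.ext (Subtype.ext hq.symm)
  have hmemS : ∀ q, (⟨ofNormal α t c hc hcX q, hQG ⟨q, rfl⟩⟩ : G) ∈ S := fun q => hcX q x₀
  have hsurj : Function.Surjective ev := by
    intro h
    obtain ⟨γ, hγ, hγh⟩ := hrange h
    obtain ⟨e, he, heγ⟩ := hG (π γ)
    obtain ⟨q, hq⟩ := (hπc (e.1.right⁻¹ * γ)).mp (by rw [map_mul, map_inv, heγ, inv_mul_cancel])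
    let g : G := ⟨e, he⟩ * ⟨ofNormal α t c hc hcX q, hQG ⟨q, rfl⟩⟩
    have hg : g.1.1.right = γ := by
      change e.1.right * c q = γ
      rw [← hq, mul_inv_cancel_left]
    have hgS : g ∈ S := by rw [hS, hg, hγ]
    have h1 := hact g.1 hgS
    rw [hg, hγh] at h1
    -- Both elements induce `γ` on `Q`, so they differ by an element of `C_H(Q) ≤ Q`, which the
    -- diagonal `Q` corrects.
    have h2 : (g.1.1.left x₀)⁻¹ * h ∈ Q := hQ (Subgroup.mem_centralizer_iff.mpr fun y hy => by
      have h3 : MulAut.conjNormal ((g.1.1.left x₀)⁻¹ * h) (⟨y, hy⟩ : Q) = ⟨y, hy⟩ := by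
        rw [map_mul, map_inv, h1, inv_mul_cancel, MulAut.one_apply]
      have h4 := congrArg Subtype.val h3
      rw [MulAut.conjNormal_apply] at h4
      exact (mul_inv_eq_iff_eq_mul.mp h4).symm)
    refine ⟨⟨g, hgS⟩ * ⟨_, hmemS ⟨_, h2⟩⟩, ?_⟩
    rw [map_mul, hev, hev, hleft, mul_inv_cancel_left]
  let φ : S ≃* H := MulEquiv.ofBijective ev ⟨hinj, hsurj⟩
  have hφ : ∀ q : Q, φ.symm q = ⟨_, hmemS q⟩ := fun q => by
    rw [MulEquiv.symm_apply_eq]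
    exact (hleft q).symm
  refine ⟨S.subtype.comp φ.symm.toMonoidHom,
    Subtype.val_injective.comp φ.symm.injective, fun g q => ?_, fun g => ?_⟩
  · refine Subtype.ext ?_
    change g.1 * (φ.symm q).1.1 * g.1⁻¹ = (φ.symm (α g.1.1.right q : Q)).1.1
    rw [hφ, hφ]
    exact conj_ofNormal hα g.1 q
  · rw [← hπX, ← hS]
    constructor
    · rintro ⟨h, rfl⟩
      exact (φ.symm h).2
    · intro hg
      exact ⟨φ ⟨g, hg⟩, by simp⟩

end twistedWreath

/-! ### Outer automorphisms and strong embedding -/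

theorem OuterAut.congr_mk {N M : Type*} [Group N] [Group M] (e : N ≃* M) (β : MulAut N) :
    OuterAut.congr e (QuotientGroup.mk' (Inn N) β) =
      QuotientGroup.mk' (Inn M) (MulAut.congr e β) := rfl

/-- Inner automorphisms of `Q` are themselves induced by `H`, so any representative of the class
will do. -/
theorem mk_mem_outIn_iff {H : Type*} [Group H] {Q : Subgroup H} [Q.Normal] {β : MulAut Q} :
    QuotientGroup.mk' (Inn Q) β ∈ outIn Q ↔ ∃ h : H, MulAut.conjNormal h = β := by
  have key : ∀ n : Subgroup.normalizer (Q : Set H),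
      Q.normalizerMonoidHom n = MulAut.conjNormal (n : H) := fun n => by
    ext q
    rfl
  constructor
  · rintro ⟨n, hn⟩
    rw [MonoidHom.comp_apply, key] at hn
    obtain ⟨q, hq⟩ := QuotientGroup.eq.mp hn
    exact ⟨n * q, by rw [map_mul, MulAut.conjNormal_val, hq, mul_inv_cancel_left]⟩
  · rintro ⟨h, rfl⟩
    exact ⟨⟨h, by rw [Subgroup.normalizer_eq_top]; trivial⟩, by rw [MonoidHom.comp_apply, key]⟩

theorem outIn_map_eq {H G : Type*} [Group H] [Group G] {Q : Subgroup H} {ι : H →* G}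
    (hι : Function.Injective ι) (ρ : G → MulAut Q)
    (hρ : ∀ g (q : Q), g * ι q * g⁻¹ = ι (ρ g q : Q)) {Δ : Subgroup (OuterAut Q)}
    (hΔ : ∀ o, o ∈ Δ ↔ ∃ g, QuotientGroup.mk' (Inn Q) (ρ g) = o) :
    (Q.map ι).Normal ∧ outIn (Q.map ι) =
      Δ.map (OuterAut.congr (Q.equivMapOfInjective ι hι) :
        OuterAut Q →* OuterAut (Q.map ι)) := by
  have hnormal : (Q.map ι).Normal := by
    refine ⟨?_⟩
    rintro _ ⟨q, hq, rfl⟩ g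
    exact ⟨_, (ρ g ⟨q, hq⟩).2, (hρ g ⟨q, hq⟩).symm⟩
  refine ⟨hnormal, ?_⟩
  have key : ∀ g, MulAut.conjNormal g = MulAut.congr (Q.equivMapOfInjective ι hι) (ρ g) := by
    intro g
    ext y
    obtain ⟨q, rfl⟩ := (Q.equivMapOfInjective ι hι).surjective y
    rw [MulAut.conjNormal_apply, Subgroup.coe_equivMapOfInjective_apply, hρ]
    simp [MulAut.congr]
  ext o
  constructor
  · intro ho
    obtain ⟨β, rfl⟩ := QuotientGroup.mk'_surjective _ o
    obtain ⟨g, rfl⟩ := mk_mem_outIn_iff.mp ho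
    exact ⟨_, (hΔ _).mpr ⟨g, rfl⟩, by rw [key]; rfl⟩
  · rintro ⟨o, ho, rfl⟩
    obtain ⟨g, rfl⟩ := (hΔ o).mp ho
    rw [MonoidHom.coe_coe, OuterAut.congr_mk, ← key]
    exact mk_mem_outIn_iff.mpr ⟨g, rfl⟩

-- Up to conjugacy, the stabilizer of two distinct cosets is `K ∩ gKg⁻¹` with `g ∉ K`.
open scoped Pointwise in
theorem IsStronglyPEmbedded.not_dvd_card_stabilizer_prod {p : ℕ} {D : Type*} [Group D]
    {K : Subgroup D} (hK : IsStronglyPEmbedded p K) {x y : D ⧸ K} (hxy : x ≠ y) :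
    ¬ p ∣ Nat.card (MulAction.stabilizer D (x, y)) := by
  obtain ⟨a, rfl⟩ := QuotientGroup.mk_surjective x
  obtain ⟨b, rfl⟩ := QuotientGroup.mk_surjective y
  have h1 : ((a : D ⧸ K), (b : D ⧸ K)) =
      a • (((1 : D) : D ⧸ K), (a⁻¹ * b) • ((1 : D) : D ⧸ K)) := by
    simp [Prod.smul_mk]
  have h2 : MulAction.stabilizer D (((1 : D) : D ⧸ K), (a⁻¹ * b) • ((1 : D) : D ⧸ K)) =
      K ⊓ MulAut.conj (a⁻¹ * b) • K := by
    have h3 : MulAction.stabilizer D ((a⁻¹ * b) • ((1 : D) : D ⧸ K)) =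
        MulAut.conj (a⁻¹ * b) • K := by
      rw [MulAction.stabilizer_smul_eq_stabilizer_map_conj, MulAction.stabilizer_quotient]
      rfl
    have h4 : ∀ d, d ∈ K ↔ d • ((1 : D) : D ⧸ K) = ((1 : D) : D ⧸ K) := fun d => by
      rw [← MulAction.mem_stabilizer_iff, MulAction.stabilizer_quotient]
    rw [← h3]
    ext d
    simp only [Subgroup.mem_inf, MulAction.mem_stabilizer_iff, Prod.smul_mk, Prod.mk.injEq, h4]
  rw [h1, MulAction.stabilizer_smul_eq_stabilizer_map_conj,
    Subgroup.card_map_of_injective (MulAut.conj a).injective, h2]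
  exact hK.not_dvd_card_inf_conj _ fun h => hxy (QuotientGroup.eq.mpr h)

theorem IsStronglyPEmbedded.not_dvd_index {p : ℕ} [Fact p.Prime] {D : Type*} [Group D] [Finite D]
    {K : Subgroup D} (hK : IsStronglyPEmbedded p K) : ¬ p ∣ K.index := by
  obtain ⟨P, hP⟩ := hK.exists_sylow_le
  exact fun h => P.not_dvd_index (h.trans (Subgroup.index_dvd_of_le hP))

/-! ### Assembling the overgroup -/

set_option maxHeartbeats 1000000 in
/-- A finite group with a normal self-centralizing `p`-subgroup `Q` is contained in an extension of
`Δ` by `Q`, for every `Δ` in which its outer action on `Q` is strongly `p`-embedded. -/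
theorem exists_overgroup {p : ℕ} [Fact p.Prime] {H : Type u} [Group H] [Finite H]
    (Q : Subgroup H) [Q.Normal] (hQp : IsPGroup p Q)
    (hQcent : Subgroup.centralizer (Q : Set H) ≤ Q)
    (Δ : Subgroup (OuterAut Q)) (hle : outIn Q ≤ Δ)
    (hΔ : IsStronglyPEmbedded p ((outIn Q).subgroupOf Δ)) :
    ∃ (G : Type u) (_ : Group G) (_ : Finite G) (ι : H →* G) (ρ : G → MulAut Q) (f : G →* Δ),
      Function.Injective ι ∧ Function.Surjective f ∧
      ι.range = ((outIn Q).subgroupOf Δ).comap f ∧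
      (∀ g (q : Q), g * ι q * g⁻¹ = ι (ρ g q : Q)) ∧
      ∀ g, QuotientGroup.mk' (Inn Q) (ρ g) = f g := by
  classical
  have hfinAut : Finite (MulAut Q) := inferInstance
  let K : Subgroup Δ := (outIn Q).subgroupOf Δ
  let mk := QuotientGroup.mk' (Inn Q)
  let Γ : Subgroup (MulAut Q) := Δ.comap mk
  let π : Γ →* Δ := mk.subgroupComap Δ
  have hπ : Function.Surjective π :=
    mk.subgroupComap_surjective_of_surjective Δ (QuotientGroup.mk'_surjective _)
  let _ : MulAction Γ (Δ ⧸ K) := MulAction.compHom _ π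
  have hπX : ∀ (γ : Γ) (x : Δ ⧸ K), γ • x = π γ • x := fun _ _ => rfl
  have hconj : ∀ q : Q, mk (MulAut.conj q) = 1 := fun q =>
    (QuotientGroup.eq_one_iff _).mpr ⟨q, rfl⟩
  let c : Q →* Γ := (MulAut.conj : Q →* MulAut Q).codRestrict Γ fun q => by
    rw [Subgroup.mem_comap, hconj]
    exact Δ.one_mem
  have hc : ∀ q, Γ.subtype (c q) = MulAut.conj q := fun _ => rfl
  have hπc : ∀ γ, π γ = 1 ↔ ∃ q, γ = c q := by
    intro γ
    constructor
    · intro h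
      obtain ⟨q, hq⟩ := (QuotientGroup.eq_one_iff _).mp (congrArg Subtype.val h)
      exact ⟨q, Subtype.ext hq.symm⟩
    · rintro ⟨q, rfl⟩
      exact Subtype.ext (hconj q)
  have hcX : ∀ q (x : Δ ⧸ K), c q • x = x := fun q x => by
    rw [hπX, (hπc _).mpr ⟨q, rfl⟩, one_smul]
  let x₀ : Δ ⧸ K := ((1 : Δ) : Δ ⧸ K)
  have hx₀ : ∀ δ : Δ, δ • x₀ = x₀ ↔ δ ∈ K := by
    intro δ
    rw [← MulAction.mem_stabilizer_iff, MulAction.stabilizer_quotient]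
  have htrans : ∀ x : Δ ⧸ K, ∃ γ : Γ, γ • x₀ = x := by
    intro x
    obtain ⟨δ, rfl⟩ := QuotientGroup.mk_surjective x
    obtain ⟨γ, rfl⟩ := hπ δ
    exact ⟨γ, by rw [hπX, MulAction.Quotient.smul_coe, smul_eq_mul, mul_one]⟩
  choose t₁ ht₁ using htrans
  -- Normalizing `t x₀ = 1` makes the coordinate at `x₀` act on `Q` untwisted, as evaluation onto
  -- `H` requires.
  let t : Δ ⧸ K → Γ := Function.update t₁ x₀ 1
  have ht₀ : t x₀ = 1 := Function.update_self ..
  have ht : ∀ x, t x • x₀ = x := by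
    intro x
    rcases eq_or_ne x x₀ with rfl | hx
    · rw [ht₀, one_smul]
    · rw [show t x = t₁ x from Function.update_of_ne hx .., ht₁]
  have hstab : ∀ γ : Γ, γ • x₀ = x₀ → ∃ h : H, MulAut.conjNormal h = Γ.subtype γ := by
    intro γ hγ
    rw [hπX, hx₀] at hγ
    exact mk_mem_outIn_iff.mp hγ
  have hrange : ∀ h : H, ∃ γ : Γ, γ • x₀ = x₀ ∧ Γ.subtype γ = MulAut.conjNormal h := by
    intro h
    have hmem : mk (MulAut.conjNormal h) ∈ outIn Q := mk_mem_outIn_iff.mpr ⟨h, rfl⟩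
    refine ⟨⟨MulAut.conjNormal h, hle hmem⟩, ?_, rfl⟩
    rw [hπX, hx₀]
    exact hmem
  have hα : Function.Injective Γ.subtype := Subtype.val_injective
  obtain ⟨G, hQG, hG, hGQ⟩ := twistedWreath.exists_extension (hc := hc) (hcX := hcX)
    hα hQp hQcent π hπ hπX hπc ht hstab
    hΔ.not_dvd_index fun x y hxy => hΔ.not_dvd_card_stabilizer_prod hxy
  obtain ⟨ι, hι, hιQ, hιG⟩ := twistedWreath.exists_embedding hα hQcent π hπX hπc ht₀ hrange
    G hQG hG hGQ
  have hfinite : Finite ((Δ ⧸ K → H) ⋊[(mulAutArrow : Γ →* MulAut (Δ ⧸ K → H))] Γ) :=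
    Finite.of_equiv _ SemidirectProduct.equivProd.symm
  refine ⟨G, inferInstance, inferInstance, ι, fun g => Γ.subtype g.1.1.right,
    π.comp ((twistedWreath.toRight Q Γ.subtype t).comp G.subtype), hι, fun δ => ?_,
    Subgroup.ext fun g => (hιG g).trans (hx₀ _), hιQ, fun g => rfl⟩
  obtain ⟨e, he, heδ⟩ := hG δ
  exact ⟨⟨e, he⟩, heδ⟩

theorem mainTheorem7 {p : ℕ} [Fact p.Prime] {H : Type u} [Group H] [Finite H]
    (hH : pPrimeCore p H = ⊥)
    (Q : Subgroup H) (hQnormal : Q.Normal) (hQp : IsPGroup p Q)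
    (hQcent : Subgroup.centralizer (Q : Set H) ≤ Q)
    (Δ : Subgroup (OuterAut Q)) (hle : outIn Q ≤ Δ)
    (hΔ : IsStronglyPEmbedded p ((outIn Q).subgroupOf Δ)) :
    ∃ (G : Type u) (_ : Group G) (_ : Finite G) (ι : H →* G) (hι : Function.Injective ι),
      ¬ p ∣ ι.range.index ∧
      (Q.map ι).Normal ∧
      outIn (Q.map ι) =
        Δ.map (OuterAut.congr (Q.equivMapOfInjective ι hι) :
          OuterAut Q →* OuterAut (Q.map ι)) ∧
      Nonempty (outIn (Q.map ι) ≃* Δ) := by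
  obtain ⟨G, hGroup, hFinite, ι, ρ, f, hι, hf, hrange, hρ, hρf⟩ :=
    exists_overgroup Q hQp hQcent Δ hle hΔ
  obtain ⟨hnormal, hout⟩ := outIn_map_eq (Δ := Δ) hι ρ hρ fun o => by
    constructor
    · intro ho
      obtain ⟨g, hg⟩ := hf ⟨o, ho⟩
      exact ⟨g, by rw [hρf, hg]⟩
    · rintro ⟨g, rfl⟩
      rw [hρf]
      exact (f g).2
  refine ⟨G, hGroup, hFinite, ι, hι, ?_, hnormal, hout, ?_⟩
  -- `H` is the full preimage of `Out_H(Q)` under `f`, so `|G : H| = |Δ : Out_H(Q)|`.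
  · rw [hrange, Subgroup.index_comap_of_surjective _ hf]
    exact hΔ.not_dvd_index
  · rw [hout]
    exact ⟨(Δ.equivMapOfInjective _ (OuterAut.congr _).injective).symm⟩
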